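/- **Laguerre spectra.** *Continuous time.* For $p>0$ let $\ell_k(s)=\frac{\sqrt{2p}}{s+p}\left(\frac{s-p}{s+p}\right)^k$, $k\ge 0$. The Laguerre spectrum of a signal $u\in L_2[0,\infty)$ with Laplace transform $U$ is $u_j=\frac1{2\pi i}\int_{i\mathbb R}U(s)\overline{\ell_j(s)}\,ds$, with boundary values taken from the right half-plane. *Discrete time.* For $0<p<1$ let $L_k(z)=\frac{\sqrt{1-p}}{z-\sqrt p}\left(\frac{1-\sqrt p\,z}{z-\sqrt p}\right)^k$, $k\ge 0$. The Laguerre spectrum of $u\in\ell^2(\mathbb N_0)$ is $u_j=\frac1{2\pi i}\oint_{|z|=1}U(z)\overline{L_j(z)}\,\frac{dz}{z}$, with boundary values taken from outside the disc. Here $U(z)=\sum_{t\ge 0}u(t)z^{-t-d}$ for a fixed $d\in\mathbb N_0$ (the usual Z-transform is $d=0$), and $U$ vanishes at infinity, as the $L_k$ do; that is, $u(0)=0$ if $d=0$, while $u$ is arbitrary if $d\ge 1$. **Toeplitz inversion.** Let $y(t)=u(t-\tau)$, with $u(t)=0$ for $t<0$, where $\tau\ge 0$ is real in continuous time and $\tau\in\mathbb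 N_0$ in discrete time. Let $(u_j)$ and $(y_j)$ be the Laguerre spectra of the real signals $u$ and $y$, and assume $u_0\neq 0$. Set $g_0=1/u_0$, $g_k=-\frac1{u_0}\sum_{j=0}^{k-1}u_{k-j}g_j$ for $k\ge 1$, and $h_k=\sum_{j=0}^k g_{k-j}y_j$ for $k\ge 0$. **Proposition.** The numbers $h_k$ are the Laguerre-domain Markov parameters of the delay: * in continuous time, $h_k=e^{-\kappa/2}\sum_{n=0}^k\frac1{n!}\binom{k-1}{k-n}(-\kappa)^n$ with $\kappa=2p\tau$ and $\binom{-1}{0}=1$; * in discrete time, with $\xi=\sqrt p$, $h_0=\xi^\tau$ and $h_k=(1-p)(-\xi)^{k-\tau}\sum_{n=0}^{\tau-1}\binom{k+n}{n}\binom{k-1}{\tau-n-1}(-\xi^2)^n$ for $k\ge1$. Moreover, for every $m\ge 1$: * *Continuous time.* $\kappa\, h_m=-\bigl((m+1)h_{m+1}+(m-1)h_{m-1}-2mh_m\bigr)$, and hence, whenever $h_m\ne0$, $$\kappa=-\frac{(m+1)h_{m+1}+(m-1)h_{m-1}-2mh_m}{h_m}.$$ * *Discrete time.* $\tau(\xi-\xi^{-1})h_m=-\bigl((m+1)h_{m+1}+(m-1)h_{m-1}+m(\xi+\xi^{-1})h_m\bigr)$,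 and hence, whenever $h_m\ne0$, $$\tau=-\frac{(m+1)h_{m+1}+(m-1)h_{m-1}+m(\xi+\xi^{-1})h_m}{(\xi-\xi^{-1})h_m}.$$ -/

import Mathlib

open Complex MeasureTheory Filter Topology

namespace LaguerreDelay

noncomputable section

/-! ### Continuous time -/

/-- The `k`-th continuous Laguerre function in the Laplace domain. -/
def laguerreC (p : ℝ) (k : ℕ) (s : ℂ) : ℂ :=
  (Real.sqrt (2 * p) : ℂ) / (s + p) * ((s - p) / (s + p)) ^ k

/-- The one-sided Laplace transform. -/
def laplace (u : ℝ → ℝ) (s : ℂ) : ℂ :=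
  ∫ t in Set.Ioi (0 : ℝ), cexp (-s * t) * (u t : ℂ)

/-- The inner product of the Hardy space of the right half-plane, that is
`(2 π i)⁻¹ ∫ W(s) conj (V(s)) ds` over the imaginary axis, the boundary being approached from
inside the half-plane. For `V` with real coefficients, `conj (V(s)) = V(-s)` on the axis. -/
def innerC (W V : ℂ → ℂ) : ℂ :=
  limUnder (𝓝[>] (0 : ℝ)) fun σ : ℝ =>
    (2 * Real.pi : ℂ)⁻¹ *
      ∫ ω : ℝ, W (σ + ω * I) * (starRingEnd ℂ) (V (σ + ω * I))

/-- The continuous Laguerre spectrum of a signal on `[0, ∞)`. -/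
def spectrumC (p : ℝ) (u : ℝ → ℝ) (j : ℕ) : ℂ :=
  innerC (laplace u) (laguerreC p j)

/-- The associated Laguerre polynomial `L_m(x; α)` for an integer parameter `α`. -/
def assocLaguerre (α : ℤ) (m : ℕ) (x : ℝ) : ℝ :=
  ∑ n ∈ Finset.range (m + 1),
    1 / (n.factorial : ℝ) * ((Ring.choose ((m : ℤ) + α) (m - n) : ℤ) : ℝ) * (-x) ^ n

/-- The Laguerre-domain Markov parameters of the continuous delay, `κ = 2 p τ`. -/
def delayMarkovC (κ : ℝ) (k : ℕ) : ℝ :=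
  Real.exp (-κ / 2) * assocLaguerre (-1) k κ

/-! ### Discrete time -/

/-- The `k`-th discrete Laguerre function in the Z-domain. -/
def laguerreD (p : ℝ) (k : ℕ) (z : ℂ) : ℂ :=
  (Real.sqrt (1 - p) : ℂ) / (z - (Real.sqrt p : ℂ)) *
    ((1 - (Real.sqrt p : ℂ) * z) / (z - (Real.sqrt p : ℂ))) ^ k

/-- The one-sided Z-transform `∑ u(t) z ^ (-t - d)`. The usual one is `d = 0`; `d = 1` is the
convention under which every square-summable `u` on `{0, 1, 2, …}` has a transform that vanishes at
infinity, as all the discrete Laguerre functions do. -/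
def zTransform (d : ℕ) (u : ℕ → ℝ) (z : ℂ) : ℂ :=
  ∑' t : ℕ, (u t : ℂ) * z ^ (-(t : ℤ) - (d : ℤ))

/-- The inner product of the Hardy space of the exterior of the unit disc, that is
`(2 π i)⁻¹ ∮ W(z) conj (V(z)) dz / z` over the unit circle, the circle being approached from
outside. -/
def innerD (W V : ℂ → ℂ) : ℂ :=
  limUnder (𝓝[>] (1 : ℝ)) fun r : ℝ =>
    (2 * Real.pi : ℂ)⁻¹ *
      ∫ θ in (0 : ℝ)..(2 * Real.pi),
        W (r * cexp (θ * I)) * (starRingEnd ℂ) (V (r * cexp (θ * I)))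

/-- The discrete Laguerre spectrum of a signal on `{0, 1, 2, …}`. -/
def spectrumD (p : ℝ) (d : ℕ) (u : ℕ → ℝ) (j : ℕ) : ℂ :=
  innerD (zTransform d u) (laguerreD p j)

/-- The polynomial `L_m^{(τ)}(ξ)`. -/
def delayPoly (τ m : ℕ) (ξ : ℝ) : ℝ :=
  (-ξ) ^ ((m : ℤ) - (τ : ℤ)) *
    ∑ n ∈ Finset.range τ,
      ((m + n).choose n : ℝ) * ((m - 1).choose (τ - n - 1) : ℝ) * (-ξ ^ 2) ^ n

/-- The Laguerre-domain Markov parameters of the discrete delay. -/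
def delayMarkovD (p : ℝ) (τ : ℕ) (k : ℕ) : ℝ :=
  if k = 0 then Real.sqrt p ^ τ else (1 - p) * delayPoly τ k (Real.sqrt p)

/-! ### Toeplitz inversion -/

/-- The first column `g` of the inverse of the lower triangular Toeplitz matrix with first
column `u`. -/
def toeplitzInv (u : ℕ → ℂ) : ℕ → ℂ
  | 0 => 1 / u 0
  | k + 1 => -(1 / u 0) * ∑ j : Fin (k + 1), u (k + 1 - j) * toeplitzInv u j

/-- The Markov parameters evaluated from an input spectrum `u` and an output spectrum `y`. -/
def markov (u y : ℕ → ℂ) (k : ℕ) : ℂ :=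
  ∑ j ∈ Finset.range (k + 1), toeplitzInv u (k - j) * y j

end

end LaguerreDelay

namespace LaguerreDelay

noncomputable section

/-! ### Toeplitz inversion as power series inversion -/

/-! Plancherel's theorem moves the spectra to the time domain: `u_j` is the pairing of `u` with the
real impulse response `φ_j` of the `j`-th Laguerre function (`spectrumC_eq_integral`,
`spectrumD_eq_tsum`). Delaying `u` amounts to advancing `φ_k`, so everything rests on an expansion
`φ_k(t + τ) = ∑_{i+j=k} h_i φ_j(t)` whose coefficients do not depend on `t` (`laguerreTimeC_add`,
`laguerreTimeD_add`). In other words, a shift by `τ` multiplies the generating function `∑ φ_k(t)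
X^k` by a fixed power series `H`.

In continuous time the generating function is `√(2p) e^{-pt} (1 - X)⁻¹ exp(-2pt X/(1 - X))`, whence
`H = e^{-κ/2} exp(-κ X/(1 - X))`. In discrete time it is `√(1-p) (1 + ξX)⁻¹ ((ξ + X)/(1 +
ξX))^(t-1)` for `t ≥ 1`, whence `H = ((ξ + X)/(1 + ξX))^τ`.

The spectra, read as power series, thus satisfy `Y = H U`. Toeplitz inversion is division by `U`, so
it returns the coefficients of `H` (`markov_eq_of_convolution`). Finally `H` solves a first-order
linear equation, `(1 - X)² H' = -κ H` or `(1 + ξX)(ξ + X) H' = τ(1 - ξ²) H`, and the coefficients of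
`X^m` on both sides give the three-term recurrences. -/

theorem mk_mul_mk_toeplitzInv (u : ℕ → ℂ) (hu : u 0 ≠ 0) :
    PowerSeries.mk u * PowerSeries.mk (toeplitzInv u) = 1 := by
  ext k
  rw [PowerSeries.coeff_mul, ← Finset.Nat.sum_antidiagonal_swap,
    Finset.Nat.sum_antidiagonal_eq_sum_range_succ_mk]
  simp only [PowerSeries.coeff_mk, Prod.fst_swap, Prod.snd_swap]
  cases k with
  | zero => simp [toeplitzInv, hu]
  | succ k =>
    -- The recursion for `g` is the vanishing of this coefficient solved for its top term `u 0 * g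
    -- (k + 1)`.
    rw [Finset.sum_range_succ, toeplitzInv,
      Fin.sum_univ_eq_sum_range (fun j => u (k + 1 - j) * toeplitzInv u j)]
    simp [PowerSeries.coeff_one]
    field_simp
    ring

theorem markov_eq_of_convolution (u y h : ℕ → ℂ) (hu : u 0 ≠ 0)
    (hy : ∀ k, y k = ∑ ij ∈ Finset.HasAntidiagonal.antidiagonal k, h ij.1 * u ij.2) (k : ℕ) :
    markov u y k = h k := by
  have hY : PowerSeries.mk y = PowerSeries.mk h * PowerSeries.mk u := by
    ext k
    simp [PowerSeries.coeff_mul, hy]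
  have key : PowerSeries.mk y * PowerSeries.mk (toeplitzInv u) = PowerSeries.mk h := by
    rw [hY, mul_assoc, mk_mul_mk_toeplitzInv u hu, mul_one]
  have := congrArg (PowerSeries.coeff k) key
  rw [PowerSeries.coeff_mul, Finset.Nat.sum_antidiagonal_eq_sum_range_succ_mk] at this
  simp only [PowerSeries.coeff_mk] at this
  rw [markov, ← this]
  exact Finset.sum_congr rfl fun _ _ => mul_comm _ _

/-! ### Generating functions of Laguerre polynomials -/

/-- The power series `X / (1 - X)`. -/
def geomTail : PowerSeries ℝ := PowerSeries.X * PowerSeries.mk 1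

/-- The generating function `exp (-x X / (1 - X))` of the Laguerre polynomials of
parameter `-1`. -/
def delaySeriesC (x : ℝ) : PowerSeries ℝ :=
  (PowerSeries.rescale (-x) (PowerSeries.exp ℝ)).subst geomTail

theorem hasSubst_geomTail : PowerSeries.HasSubst geomTail :=
  PowerSeries.HasSubst.of_constantCoeff_zero' (by simp [geomTail])

theorem delaySeriesC_add (x y : ℝ) :
    delaySeriesC (x + y) = delaySeriesC x * delaySeriesC y := by
  rw [delaySeriesC, delaySeriesC, delaySeriesC, ← PowerSeries.subst_mul hasSubst_geomTail,
    PowerSeries.exp_mul_exp_eq_exp_add, neg_add]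

theorem one_sub_X_mul_mk_one :
    (1 - PowerSeries.X : PowerSeries ℝ) * PowerSeries.mk 1 = 1 := by
  rw [mul_comm, PowerSeries.mk_one_mul_one_sub_eq_one]

theorem geomTail_pow (n : ℕ) :
    geomTail ^ n = PowerSeries.X ^ n * (PowerSeries.mk 1 : PowerSeries ℝ) ^ n :=
  mul_pow _ _ _

theorem coeff_geomTail_pow_of_lt {n m : ℕ} (h : m < n) :
    PowerSeries.coeff m (geomTail ^ n) = 0 := by
  rw [geomTail_pow, PowerSeries.coeff_X_pow_mul', if_neg (by omega)]

theorem coeff_geomTail_pow {n m : ℕ} (h : n ≤ m) :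
    PowerSeries.coeff m (geomTail ^ n) =
      ((Ring.choose ((m : ℤ) + (-1)) (m - n) : ℤ) : ℝ) := by
  rw [geomTail_pow, PowerSeries.coeff_X_pow_mul', if_pos h]
  rcases n with _ | n
  -- The zeroth power is `1`: the generalized binomial is `(-1 choose 0) = 1` at `m = 0` and `(m
  -- choose m + 1) = 0` at `m + 1`.
  · rcases m with _ | m
    · simp
    · rw [show (((m + 1 : ℕ) : ℤ) + (-1)) = (m : ℤ) by push_cast; ring, Ring.choose_natCast]
      simp [PowerSeries.coeff_one]
  · obtain ⟨m, rfl⟩ : ∃ l, m = l + 1 := ⟨m - 1, by omega⟩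
    rw [show (((m + 1 : ℕ) : ℤ) + (-1)) = (m : ℤ) by push_cast; ring, Ring.choose_natCast,
      PowerSeries.mk_one_pow_eq_mk_choose_add, PowerSeries.coeff_mk]
    rw [show n + (m + 1 - (n + 1)) = m by omega, show m + 1 - (n + 1) = m - n by omega,
      Nat.choose_symm (by omega)]
    simp

theorem coeff_geomTail_pow_mul_mk_one {n m : ℕ} (h : n ≤ m) :
    PowerSeries.coeff m (geomTail ^ n * PowerSeries.mk 1) = (m.choose n : ℝ) := by
  rw [geomTail_pow, mul_assoc, ← pow_succ, PowerSeries.coeff_X_pow_mul', if_pos h,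
    PowerSeries.mk_one_pow_eq_mk_choose_add, PowerSeries.coeff_mk, show n + (m - n) = m by omega]

/-- Since `geomTail` has order one, powers above `k` do not contribute. The free bound `N` gives all
coefficients up to `N` a common range of summation, so that sums can be exchanged in a Cauchy
product. -/
theorem coeff_delaySeriesC_eq_sum (x : ℝ) {k N : ℕ} (h : k ≤ N) :
    PowerSeries.coeff k (delaySeriesC x) =
      ∑ n ∈ Finset.range (N + 1), (-x) ^ n / n.factorial * PowerSeries.coeff k (geomTail ^ n) := by
  rw [delaySeriesC, PowerSeries.coeff_subst' hasSubst_geomTail,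
    finsum_eq_sum_of_support_subset (s := Finset.range (N + 1))]
  · refine Finset.sum_congr rfl fun n _ => ?_
    simp [PowerSeries.coeff_exp, PowerSeries.coeff_rescale, div_eq_mul_inv]
  · intro n hn
    by_contra hlt
    simp only [Finset.coe_range, Set.mem_Iio, not_lt] at hlt
    exact hn (by simp [coeff_geomTail_pow_of_lt (show k < n by omega)])

theorem coeff_delaySeriesC (x : ℝ) (k : ℕ) :
    PowerSeries.coeff k (delaySeriesC x) = assocLaguerre (-1) k x := by
  rw [coeff_delaySeriesC_eq_sum x le_rfl, assocLaguerre]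
  refine Finset.sum_congr rfl fun n hn => ?_
  rw [coeff_geomTail_pow (by simpa [Nat.lt_succ_iff] using hn)]
  ring

/-- The Laguerre polynomial of degree `k`. -/
def laguerrePoly (k : ℕ) (x : ℝ) : ℝ :=
  ∑ n ∈ Finset.range (k + 1), (k.choose n : ℝ) * ((-x) ^ n / n.factorial)

theorem coeff_delaySeriesC_mul_mk_one (x : ℝ) (k : ℕ) :
    PowerSeries.coeff k (delaySeriesC x * PowerSeries.mk 1) = laguerrePoly k x := by
  rw [PowerSeries.coeff_mul]
  have h1 : ∀ ij ∈ Finset.HasAntidiagonal.antidiagonal k,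
      PowerSeries.coeff ij.1 (delaySeriesC x) * PowerSeries.coeff ij.2 (PowerSeries.mk 1) =
        ∑ n ∈ Finset.range (k + 1), (-x) ^ n / n.factorial *
          (PowerSeries.coeff ij.1 (geomTail ^ n) * PowerSeries.coeff ij.2 (PowerSeries.mk 1)) := by
    intro ij hij
    rw [coeff_delaySeriesC_eq_sum x (show ij.1 ≤ k by have := Finset.HasAntidiagonal.mem_antidiagonal.1 hij; omega), Finset.sum_mul]
    exact Finset.sum_congr rfl fun _ _ => mul_assoc _ _ _
  rw [Finset.sum_congr rfl h1, Finset.sum_comm, laguerrePoly]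
  refine Finset.sum_congr rfl fun n hn => ?_
  rw [← Finset.mul_sum, ← PowerSeries.coeff_mul,
    coeff_geomTail_pow_mul_mk_one (by simpa [Nat.lt_succ_iff] using hn), mul_comm]

/-- The addition formula is the exponential law for `delaySeriesC`, with the factor `1 / (1 - X)`
left on one side only. -/
theorem laguerrePoly_add (x y : ℝ) (k : ℕ) :
    laguerrePoly k (x + y) =
      ∑ ij ∈ Finset.HasAntidiagonal.antidiagonal k, assocLaguerre (-1) ij.1 y * laguerrePoly ij.2 x := by
  rw [← coeff_delaySeriesC_mul_mk_one, add_comm, delaySeriesC_add, mul_assoc,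
    PowerSeries.coeff_mul]
  simp only [coeff_delaySeriesC, coeff_delaySeriesC_mul_mk_one]

/-- Chain rule: the exponent `-x X / (1 - X)` has derivative `-x / (1 - X)²`. -/
theorem derivative_delaySeriesC (x : ℝ) :
    (1 - PowerSeries.X) ^ 2 * PowerSeries.derivative ℝ (delaySeriesC x) =
      PowerSeries.C (-x) * delaySeriesC x := by
  have hR : PowerSeries.derivative ℝ (PowerSeries.rescale (-x) (PowerSeries.exp ℝ)) =
      (-x) • PowerSeries.rescale (-x) (PowerSeries.exp ℝ) := by
    ext n
    simp [PowerSeries.coeff_derivative, PowerSeries.coeff_rescale, PowerSeries.coeff_exp,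
      Nat.factorial_succ, pow_succ]
    field_simp
  have h1 := one_sub_X_mul_mk_one
  have hd := congrArg (PowerSeries.derivative ℝ) h1
  have hP : (1 - PowerSeries.X) ^ 2 * PowerSeries.derivative ℝ geomTail = 1 := by
    simp only [Derivation.leibniz, map_sub, smul_eq_mul, Derivation.map_one_eq_zero,
      PowerSeries.derivative_X, geomTail] at hd ⊢
    linear_combination (1 - PowerSeries.X) * PowerSeries.X * hd + h1
  rw [delaySeriesC, PowerSeries.derivative_subst hasSubst_geomTail, hR,
    PowerSeries.subst_smul hasSubst_geomTail, PowerSeries.smul_eq_C_mul]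
  linear_combination (PowerSeries.C (-x) *
    (PowerSeries.rescale (-x) (PowerSeries.exp ℝ)).subst geomTail) * hP

theorem assocLaguerre_neg_one_recurrence (x : ℝ) (m : ℕ) :
    x * assocLaguerre (-1) (m + 1) x =
      -(((m + 1 : ℕ) + 1) * assocLaguerre (-1) (m + 2) x + m * assocLaguerre (-1) m x
        - 2 * (m + 1 : ℕ) * assocLaguerre (-1) (m + 1) x) := by
  have h := congrArg (PowerSeries.coeff (m + 1)) (derivative_delaySeriesC x)
  have e : (1 - PowerSeries.X : PowerSeries ℝ) ^ 2 * PowerSeries.derivative ℝ (delaySeriesC x) =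
      PowerSeries.derivative ℝ (delaySeriesC x)
        - 2 • (PowerSeries.X * PowerSeries.derivative ℝ (delaySeriesC x))
        + PowerSeries.X * (PowerSeries.X * PowerSeries.derivative ℝ (delaySeriesC x)) := by
    rw [nsmul_eq_mul]; push_cast; ring
  rw [e] at h
  simp only [map_sub, map_add, map_nsmul, PowerSeries.coeff_succ_X_mul,
    PowerSeries.coeff_C_mul, PowerSeries.coeff_derivative, coeff_delaySeriesC] at h
  rcases m with _ | m
  · simp at h ⊢
    linarith
  · simp only [PowerSeries.coeff_succ_X_mul, PowerSeries.coeff_derivative, coeff_delaySeriesC,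
      nsmul_eq_mul] at h
    push_cast at h ⊢
    linarith

/-! ### Generating functions for the discrete delay -/

/-- The geometric power series `1 / (1 - a X)`. -/
def geomSeries (a : ℝ) : PowerSeries ℝ := PowerSeries.mk fun n => a ^ n

theorem one_sub_C_mul_X_mul_geomSeries (a : ℝ) :
    (1 - PowerSeries.C a * PowerSeries.X) * geomSeries a = 1 := by
  ext n
  rw [sub_mul, one_mul, mul_assoc, map_sub, PowerSeries.coeff_C_mul]
  cases n with
  | zero => simp [geomSeries]
  | succ n =>
    rw [PowerSeries.coeff_succ_X_mul]
    simp [geomSeries, PowerSeries.coeff_one, pow_succ']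

/-- The generating function `(ξ + X) / (1 + ξ X)` of the Markov parameters of the unit delay. -/
def delaySeriesD (ξ : ℝ) : PowerSeries ℝ :=
  (PowerSeries.C ξ + PowerSeries.X) * geomSeries (-ξ)

theorem one_add_C_mul_X_mul_geomSeries (ξ : ℝ) :
    (1 + PowerSeries.C ξ * PowerSeries.X) * geomSeries (-ξ) = 1 := by
  simpa only [map_neg, neg_mul, sub_neg_eq_add] using one_sub_C_mul_X_mul_geomSeries (-ξ)

theorem one_add_C_mul_X_mul_delaySeriesD (ξ : ℝ) :
    (1 + PowerSeries.C ξ * PowerSeries.X) * delaySeriesD ξ = PowerSeries.C ξ + PowerSeries.X := by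
  rw [delaySeriesD]
  linear_combination (PowerSeries.C ξ + PowerSeries.X) * one_add_C_mul_X_mul_geomSeries ξ

theorem coeff_zero_delaySeriesD_pow (ξ : ℝ) (τ : ℕ) :
    PowerSeries.coeff 0 (delaySeriesD ξ ^ τ) = ξ ^ τ := by
  simp [delaySeriesD, geomSeries]

/-- Clearing the denominator of one factor gives a Pascal-type rule, which determines all
coefficients from the edges `τ = 0` and `k = 0`. -/
theorem coeff_succ_delaySeriesD_pow_succ (ξ : ℝ) (τ k : ℕ) :
    PowerSeries.coeff (k + 1) (delaySeriesD ξ ^ (τ + 1)) =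
      -ξ * PowerSeries.coeff k (delaySeriesD ξ ^ (τ + 1))
        + ξ * PowerSeries.coeff (k + 1) (delaySeriesD ξ ^ τ)
        + PowerSeries.coeff k (delaySeriesD ξ ^ τ) := by
  have h : delaySeriesD ξ ^ (τ + 1)
      + PowerSeries.C ξ * (PowerSeries.X * delaySeriesD ξ ^ (τ + 1)) =
      PowerSeries.C ξ * delaySeriesD ξ ^ τ + PowerSeries.X * delaySeriesD ξ ^ τ := by
    rw [pow_succ]
    linear_combination delaySeriesD ξ ^ τ * one_add_C_mul_X_mul_delaySeriesD ξ
  have := congrArg (PowerSeries.coeff (k + 1)) h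
  simp only [map_add, PowerSeries.coeff_C_mul, PowerSeries.coeff_succ_X_mul] at this
  linarith

theorem derivative_delaySeriesD_pow (ξ : ℝ) (τ : ℕ) :
    (1 + PowerSeries.C ξ * PowerSeries.X) * (PowerSeries.C ξ + PowerSeries.X) *
        PowerSeries.derivative ℝ (delaySeriesD ξ ^ τ) =
      PowerSeries.C (τ * (1 - ξ ^ 2)) * delaySeriesD ξ ^ τ := by
  have h1 := one_add_C_mul_X_mul_delaySeriesD ξ
  have hd := congrArg (PowerSeries.derivative ℝ) h1
  simp only [Derivation.leibniz, map_add, smul_eq_mul, Derivation.map_one_eq_zero,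
    PowerSeries.derivative_X, PowerSeries.derivative_C] at hd
  rcases τ with _ | τ
  · simp
  rw [Derivation.leibniz_pow]
  simp only [map_mul, map_sub, map_pow, map_natCast, nsmul_eq_mul, smul_eq_mul,
    add_tsub_cancel_right, map_one]
  -- Logarithmic derivative of the Möbius map `(ξ + X) / (1 + ξ X)`; the `τ`-th power multiplies it
  -- by `τ`.
  have key : (1 + PowerSeries.C ξ * PowerSeries.X) * (PowerSeries.C ξ + PowerSeries.X) *
      PowerSeries.derivative ℝ (delaySeriesD ξ) =
      (1 - PowerSeries.C ξ ^ 2) * delaySeriesD ξ := by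
    linear_combination (PowerSeries.C ξ + PowerSeries.X) * hd - h1
  rw [pow_succ (delaySeriesD ξ)]
  linear_combination ((τ + 1 : ℕ) : PowerSeries ℝ) * delaySeriesD ξ ^ τ * key

theorem coeff_delaySeriesD_pow_recurrence (ξ : ℝ) (hξ : ξ ≠ 0) (τ m : ℕ) :
    τ * ((ξ - ξ⁻¹) * PowerSeries.coeff (m + 1) (delaySeriesD ξ ^ τ)) =
      -(((m + 1 : ℕ) + 1) * PowerSeries.coeff (m + 2) (delaySeriesD ξ ^ τ)
        + m * PowerSeries.coeff m (delaySeriesD ξ ^ τ)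
        + (m + 1 : ℕ) * (ξ + ξ⁻¹) * PowerSeries.coeff (m + 1) (delaySeriesD ξ ^ τ)) := by
  have h := congrArg (PowerSeries.coeff (m + 1)) (derivative_delaySeriesD_pow ξ τ)
  set D := PowerSeries.derivative ℝ (delaySeriesD ξ ^ τ) with hD
  have e : (1 + PowerSeries.C ξ * PowerSeries.X) * (PowerSeries.C ξ + PowerSeries.X) * D =
      PowerSeries.C ξ * D + PowerSeries.C (1 + ξ ^ 2) * (PowerSeries.X * D)
        + PowerSeries.C ξ * (PowerSeries.X * (PowerSeries.X * D)) := by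
    simp only [map_add, map_one, map_pow]; ring
  rw [e, map_add, map_add] at h
  simp only [PowerSeries.coeff_succ_X_mul, PowerSeries.coeff_C_mul] at h
  have h2 : PowerSeries.coeff m (PowerSeries.X * D) =
      m * PowerSeries.coeff m (delaySeriesD ξ ^ τ) := by
    rcases m with _ | m
    · simp
    · rw [PowerSeries.coeff_succ_X_mul, hD, PowerSeries.coeff_derivative]; push_cast; ring
  rw [h2, hD] at h
  simp only [PowerSeries.coeff_derivative] at h
  -- The coefficient identity `h` is the claim multiplied by `ξ`.
  field_simp
  push_cast at h ⊢
  linear_combination h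

/-! ### The closed form of the discrete Markov parameters -/

/-- The binomial sum in `delayPoly`, as a function of `q = -ξ ^ 2`. -/
def delaySum (τ k : ℕ) (q : ℝ) : ℝ :=
  ∑ n ∈ Finset.range τ, ((k + n).choose n : ℝ) * ((k - 1).choose (τ - n - 1) : ℝ) * q ^ n

/-- The power series `∑ (k + n).choose n * q ^ n * X ^ n`. -/
def binomSeries (k : ℕ) (q : ℝ) : PowerSeries ℝ :=
  PowerSeries.mk fun n => ((k + n).choose n : ℝ) * q ^ n

theorem one_sub_mul_binomSeries (k : ℕ) (q : ℝ) :
    (1 - PowerSeries.C q * PowerSeries.X) * binomSeries (k + 1) q = binomSeries k q := by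
  ext n
  rw [sub_mul, one_mul, mul_assoc, map_sub, PowerSeries.coeff_C_mul]
  cases n with
  | zero => simp [binomSeries]
  | succ n =>
    rw [PowerSeries.coeff_succ_X_mul]
    simp only [binomSeries, PowerSeries.coeff_mk]
    rw [show k + 1 + (n + 1) = (k + 1 + n) + 1 by ring, Nat.choose_succ_succ,
      show k + (n + 1) = k + 1 + n by ring]
    push_cast
    ring

/-- As `binomSeries k q` is `(1 - q X)^(-k-1)`, the binomial sum is a coefficient of the rational
function `(1 + X)^k / (1 - q X)^(k+2)`. -/
theorem delaySum_eq_coeff (τ k : ℕ) (q : ℝ) :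
    delaySum (τ + 1) (k + 1) q =
      PowerSeries.coeff τ (binomSeries (k + 1) q * (1 + PowerSeries.X) ^ k) := by
  have h : ∀ j, PowerSeries.coeff j ((1 + PowerSeries.X : PowerSeries ℝ) ^ k) =
      (k.choose j : ℝ) := by
    intro j
    have := Polynomial.coeff_one_add_X_pow ℝ k j
    rw [← this, ← Polynomial.coeff_coe]
    simp
  rw [PowerSeries.coeff_mul, Finset.Nat.sum_antidiagonal_eq_sum_range_succ_mk, delaySum]
  refine Finset.sum_congr rfl fun n _ => ?_
  rw [h, binomSeries, PowerSeries.coeff_mk, show τ + 1 - n - 1 = τ - n by omega,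
    add_tsub_cancel_right]
  ring

/-- Raising `k` by one multiplies that rational function by `(1 + X) / (1 - q X)`. With `q = -ξ ^ 2`
and the factor `(-ξ)^(k-τ)` this becomes the Pascal-type rule of `delaySeriesD`. -/
theorem delaySum_recurrence (τ k : ℕ) (q : ℝ) :
    delaySum (τ + 1) (k + 2) q = delaySum (τ + 1) (k + 1) q + q * delaySum τ (k + 2) q
      + delaySum τ (k + 1) q := by
  have h : binomSeries (k + 2) q * (1 + PowerSeries.X) ^ (k + 1) =
      binomSeries (k + 1) q * (1 + PowerSeries.X) ^ k
      + PowerSeries.C q * (PowerSeries.X * (binomSeries (k + 2) q * (1 + PowerSeries.X) ^ (k + 1)))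
      + PowerSeries.X * (binomSeries (k + 1) q * (1 + PowerSeries.X) ^ k) := by
    rw [← one_sub_mul_binomSeries (k + 1) q]
    ring
  have := congrArg (PowerSeries.coeff τ) h
  rw [delaySum_eq_coeff, delaySum_eq_coeff, this]
  simp only [map_add, PowerSeries.coeff_C_mul]
  rcases τ with _ | τ
  · simp [delaySum]
  · simp only [PowerSeries.coeff_succ_X_mul, delaySum_eq_coeff]

theorem delaySum_one (τ : ℕ) (q : ℝ) : delaySum (τ + 1) 1 q = (τ + 1) * q ^ τ := by
  rw [delaySum, Finset.sum_range_succ, Finset.sum_eq_zero]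
  · simp [add_comm 1 τ]
  · intro n hn
    have hlt : n < τ := Finset.mem_range.1 hn
    rw [Nat.choose_eq_zero_of_lt (show 1 - 1 < τ + 1 - n - 1 by omega)]
    simp

theorem coeff_delaySeriesD_pow (ξ : ℝ) (hξ : ξ ≠ 0) (τ k : ℕ) :
    PowerSeries.coeff (k + 1) (delaySeriesD ξ ^ τ) = (1 - ξ ^ 2) * delayPoly τ (k + 1) ξ := by
  have hd : ∀ τ k, delayPoly τ k ξ = (-ξ) ^ ((k : ℤ) - τ) * delaySum τ k (-ξ ^ 2) :=
    fun _ _ => rfl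
  have hn : -ξ ≠ 0 := neg_ne_zero.2 hξ
  induction τ generalizing k with
  | zero => simp [delayPoly, PowerSeries.coeff_one]
  | succ τ ih =>
    induction k with
    | zero =>
      rw [coeff_succ_delaySeriesD_pow_succ, ih, coeff_zero_delaySeriesD_pow,
        coeff_zero_delaySeriesD_pow, hd, hd]
      rw [show ((0 + 1 : ℕ) : ℤ) - (τ + 1 : ℕ) = -τ by push_cast; ring,
        show ((0 + 1 : ℕ) : ℤ) - τ = 1 + -τ by push_cast; ring, zpow_add₀ hn, zpow_one,
        zpow_neg, zpow_natCast]
      rw [delaySum_one]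
      have hp : (-ξ ^ 2) ^ τ = (-ξ) ^ τ * ξ ^ τ := by rw [← mul_pow]; ring
      have hp' : (-ξ) ^ τ ≠ 0 := pow_ne_zero _ hn
      rw [hp]
      -- For `τ = 0` the sum in `delayPoly` is empty, and `delaySum_one` does not apply.
      rcases τ with _ | τ
      · simp [delaySum]; ring
      · rw [delaySum_one]
        have hp : (-ξ ^ 2) ^ τ = (-ξ) ^ τ * ξ ^ τ := by rw [← mul_pow]; ring
        rw [hp]
        push_cast
        field_simp
        ring
    | succ k ihk =>
      rw [coeff_succ_delaySeriesD_pow_succ, ih, ih, ihk, hd, hd, hd, hd, delaySum_recurrence]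
      rw [show ((k + 1 + 1 : ℕ) : ℤ) - (τ + 1 : ℕ) = ((k : ℤ) - τ) + 1 by push_cast; ring,
        show ((k + 1 : ℕ) : ℤ) - (τ + 1 : ℕ) = ((k : ℤ) - τ) by push_cast; ring,
        show ((k + 1 : ℕ) : ℤ) - τ = ((k : ℤ) - τ) + 1 by push_cast; ring,
        show ((k + 1 + 1 : ℕ) : ℤ) - τ = ((k : ℤ) - τ) + 1 + 1 by push_cast; ring,
        zpow_add_one₀ hn, zpow_add_one₀ hn]
      ring

theorem coeff_delaySeriesD_pow_eq_delayMarkovD (p : ℝ) (hp : 0 < p) (τ k : ℕ) :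
    PowerSeries.coeff k (delaySeriesD (Real.sqrt p) ^ τ) = delayMarkovD p τ k := by
  rcases k with _ | k
  · rw [coeff_zero_delaySeriesD_pow, delayMarkovD, if_pos rfl]
  · rw [coeff_delaySeriesD_pow _ (Real.sqrt_pos.2 hp).ne', delayMarkovD, if_neg (by omega),
      Real.sq_sqrt hp.le]

/-! ### Discrete Laguerre functions in the time domain -/

/-- The power series `(X - ξ) / (1 - ξ X)`. -/
def blaschkeSeries (ξ : ℝ) : PowerSeries ℝ :=
  (PowerSeries.X - PowerSeries.C ξ) * geomSeries ξ

theorem one_sub_C_mul_X_mul_blaschkeSeries (ξ : ℝ) :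
    (1 - PowerSeries.C ξ * PowerSeries.X) * blaschkeSeries ξ = PowerSeries.X - PowerSeries.C ξ := by
  rw [blaschkeSeries]
  linear_combination (PowerSeries.X - PowerSeries.C ξ) * one_sub_C_mul_X_mul_geomSeries ξ

/-- The expansion of the `k`-th discrete Laguerre function in powers of `z⁻¹`. -/
def laguerreSeriesD (p : ℝ) (k : ℕ) : PowerSeries ℝ :=
  PowerSeries.C (Real.sqrt (1 - p)) * (PowerSeries.X * geomSeries (Real.sqrt p)) *
    blaschkeSeries (Real.sqrt p) ^ k

/-- The impulse response of the `k`-th discrete Laguerre function. -/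
def laguerreTimeD (p : ℝ) (k n : ℕ) : ℝ := PowerSeries.coeff n (laguerreSeriesD p k)

theorem laguerreTimeD_zero_succ_succ (p : ℝ) (n : ℕ) :
    laguerreTimeD p 0 (n + 2) = Real.sqrt p * laguerreTimeD p 0 (n + 1) := by
  simp only [laguerreTimeD, laguerreSeriesD, pow_zero, mul_one, PowerSeries.coeff_C_mul,
    PowerSeries.coeff_succ_X_mul, geomSeries, PowerSeries.coeff_mk]
  ring

theorem laguerreTimeD_succ_succ (p : ℝ) (k n : ℕ) :
    laguerreTimeD p (k + 1) (n + 1) = Real.sqrt p * laguerreTimeD p (k + 1) n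
      + laguerreTimeD p k n - Real.sqrt p * laguerreTimeD p k (n + 1) := by
  have h : laguerreSeriesD p (k + 1)
      - PowerSeries.C (Real.sqrt p) * (PowerSeries.X * laguerreSeriesD p (k + 1)) =
      PowerSeries.X * laguerreSeriesD p k
        - PowerSeries.C (Real.sqrt p) * laguerreSeriesD p k := by
    rw [laguerreSeriesD, laguerreSeriesD, pow_succ]
    linear_combination PowerSeries.C (Real.sqrt (1 - p)) *
      (PowerSeries.X * geomSeries (Real.sqrt p)) * blaschkeSeries (Real.sqrt p) ^ k *
      one_sub_C_mul_X_mul_blaschkeSeries (Real.sqrt p)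
  have := congrArg (PowerSeries.coeff (n + 1)) h
  simp only [map_sub, PowerSeries.coeff_C_mul, PowerSeries.coeff_succ_X_mul] at this
  simp only [laguerreTimeD]
  linarith

/-- Each unit shift in time multiplies the generating function over `k` by the same Möbius factor.
The times start at `n + 1` because the impulse responses vanish at time `0`, where this geometric
behaviour fails. -/
theorem mk_laguerreTimeD_add (p : ℝ) (n τ : ℕ) :
    PowerSeries.mk (fun k => laguerreTimeD p k (n + 1 + τ)) =
      delaySeriesD (Real.sqrt p) ^ τ * PowerSeries.mk (fun k => laguerreTimeD p k (n + 1)) := by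
  induction τ with
  | zero => simp
  | succ τ ih =>
    rw [pow_succ', mul_assoc, ← ih]
    have h : (1 + PowerSeries.C (Real.sqrt p) * PowerSeries.X) *
        PowerSeries.mk (fun k => laguerreTimeD p k (n + 1 + (τ + 1))) =
        (PowerSeries.C (Real.sqrt p) + PowerSeries.X) *
        PowerSeries.mk (fun k => laguerreTimeD p k (n + 1 + τ)) := by
      ext k
      rw [add_mul, add_mul, one_mul, mul_assoc]
      rcases k with _ | k
      · simp only [map_add, PowerSeries.coeff_C_mul, PowerSeries.coeff_zero_X_mul,
          PowerSeries.coeff_mk]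
        rw [show n + 1 + (τ + 1) = n + τ + 2 by ring, show n + 1 + τ = n + τ + 1 by ring,
          laguerreTimeD_zero_succ_succ]
        ring
      · simp only [map_add, PowerSeries.coeff_C_mul, PowerSeries.coeff_succ_X_mul,
          PowerSeries.coeff_mk]
        rw [show n + 1 + (τ + 1) = n + 1 + τ + 1 by ring, laguerreTimeD_succ_succ]
        ring
    rw [delaySeriesD]
    linear_combination geomSeries (-Real.sqrt p) * h -
      PowerSeries.mk (fun k => laguerreTimeD p k (n + 1 + (τ + 1))) *
        one_add_C_mul_X_mul_geomSeries (Real.sqrt p)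

theorem laguerreTimeD_add (p : ℝ) (hp : 0 < p) (k τ n : ℕ) (hn : n ≠ 0) :
    laguerreTimeD p k (n + τ) =
      ∑ ij ∈ Finset.HasAntidiagonal.antidiagonal k,
        delayMarkovD p τ ij.1 * laguerreTimeD p ij.2 n := by
  obtain ⟨n, rfl⟩ := Nat.exists_eq_succ_of_ne_zero hn
  have := congrArg (PowerSeries.coeff k) (mk_laguerreTimeD_add p n τ)
  rw [PowerSeries.coeff_mul] at this
  simpa only [PowerSeries.coeff_mk, coeff_delaySeriesD_pow_eq_delayMarkovD p hp] using this

/-! ### Plancherel's theorem on `L¹ ∩ L²` -/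

open scoped FourierTransform ContDiff in
-- Both transforms are locally integrable and have the same integral against every test function:
-- each time the Fourier transform can be moved onto the test function.
theorem coeFn_fourier_toLp {f : ℝ → ℂ} (h1 : Integrable f) (h2 : MemLp f 2) :
    ((𝓕 (h2.toLp f) : Lp ℂ 2 (volume : Measure ℝ)) : ℝ → ℂ) =ᵐ[volume] 𝓕 f := by
  have hcont : Continuous (𝓕 f) :=
    VectorFourier.fourierIntegral_continuous Real.continuous_fourierChar
      (innerSL ℝ).continuous₂ h1
  refine ae_eq_of_integral_contDiff_smul_eq
    ((Lp.memLp _).locallyIntegrable (by norm_num)) hcont.locallyIntegrable ?_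
  intro g g_smooth g_cpt
  have hg₁ : HasCompactSupport (Complex.ofRealCLM ∘ g) := g_cpt.comp_left rfl
  have hg₂ : ContDiff ℝ ∞ (Complex.ofRealCLM ∘ g) := by fun_prop
  set G : SchwartzMap ℝ ℂ := hg₁.toSchwartzMap hg₂ with hG
  have e := congrArg (fun T : TemperedDistribution ℝ ℂ => T G)
    (Lp.fourier_toTemperedDistribution_eq (h2.toLp f))
  simp only [TemperedDistribution.fourier_apply, Lp.toTemperedDistribution_apply] at e
  have hflip : ∫ ξ, 𝓕 (G : ℝ → ℂ) ξ • f ξ = ∫ x, G x • 𝓕 f x := by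
    simpa using! VectorFourier.integral_fourierIntegral_smul_eq_flip
      (L := innerₗ ℝ) Real.continuous_fourierChar continuous_inner G.integrable h1
  calc
    _ = ∫ x, G x • (𝓕 (h2.toLp f) : Lp ℂ 2 (volume : Measure ℝ)) x := by simp [hG]
    _ = ∫ x, (𝓕 G : SchwartzMap ℝ ℂ) x • (h2.toLp f) x := e.symm
    _ = ∫ x, 𝓕 (G : ℝ → ℂ) x • f x := by
      refine integral_congr_ae ?_
      filter_upwards [h2.coeFn_toLp] with x hx
      rw [hx, SchwartzMap.fourier_coe]
    _ = _ := by rw [hflip]; simp [hG]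

open scoped FourierTransform in
theorem integral_fourier_mul_conj_fourier {f g : ℝ → ℂ} (hf1 : Integrable f) (hf2 : MemLp f 2)
    (hg1 : Integrable g) (hg2 : MemLp g 2) :
    ∫ w, 𝓕 f w * (starRingEnd ℂ) (𝓕 g w) = ∫ t, f t * (starRingEnd ℂ) (g t) := by
  have h := Lp.inner_fourier_eq (hg2.toLp g) (hf2.toLp f)
  rw [L2.inner_def, L2.inner_def] at h
  calc
    _ = ∫ w, inner ℂ ((𝓕 (hg2.toLp g) : Lp ℂ 2 (volume : Measure ℝ)) w)
          ((𝓕 (hf2.toLp f) : Lp ℂ 2 (volume : Measure ℝ)) w) := by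
      refine integral_congr_ae ?_
      filter_upwards [coeFn_fourier_toLp hf1 hf2, coeFn_fourier_toLp hg1 hg2] with w h1 h2
      rw [h1, h2]
      rfl
    _ = _ := h
    _ = _ := by
      refine integral_congr_ae ?_
      filter_upwards [hf2.coeFn_toLp, hg2.coeFn_toLp] with w h1 h2
      rw [h1, h2]
      rfl

/-- The one-sided Laplace transform on a vertical line is a Fourier transform. -/
theorem laplace_line_eq_fourier (f : ℝ → ℝ) (σ ω : ℝ) :
    laplace f (σ + ω * I) =
      FourierTransform.fourier ((Set.Ioi (0 : ℝ)).indicator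
        fun t => ((Real.exp (-σ * t) * f t : ℝ) : ℂ)) (ω / (2 * Real.pi)) := by
  rw [Real.fourier_real_eq_integral_exp_smul, laplace, ← integral_indicator measurableSet_Ioi]
  congr 1
  ext t
  by_cases ht : t ∈ Set.Ioi (0 : ℝ)
  · rw [Set.indicator_of_mem ht, Set.indicator_of_mem ht]
    push_cast
    rw [smul_eq_mul, ← mul_assoc, ← Complex.exp_add]
    congr 2
    have : (Real.pi : ℂ) ≠ 0 := by exact_mod_cast Real.pi_ne_zero
    field_simp
    ring
  · rw [Set.indicator_of_notMem ht, Set.indicator_of_notMem ht, smul_zero]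

/-- Plancherel on the line `Re s = σ`, for the damped functions `e^{-σt} f` and `e^{-σt} g`. The
factor `2π` comes from `ω = 2πw`, where `w` is the frequency variable of `𝓕`. -/
theorem integral_laplace_mul_conj_laplace {f g : ℝ → ℝ} {σ : ℝ}
    (hf1 : IntegrableOn (fun t => Real.exp (-σ * t) * f t) (Set.Ioi 0))
    (hf2 : MemLp (fun t => Real.exp (-σ * t) * f t) 2 (volume.restrict (Set.Ioi 0)))
    (hg1 : IntegrableOn (fun t => Real.exp (-σ * t) * g t) (Set.Ioi 0))
    (hg2 : MemLp (fun t => Real.exp (-σ * t) * g t) 2 (volume.restrict (Set.Ioi 0))) :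
    (2 * Real.pi : ℂ)⁻¹ * ∫ ω : ℝ,
        laplace f (σ + ω * I) * (starRingEnd ℂ) (laplace g (σ + ω * I)) =
      ((∫ t in Set.Ioi (0 : ℝ), Real.exp (-2 * σ * t) * (f t * g t) : ℝ) : ℂ) := by
  simp only [laplace_line_eq_fourier]
  rw [MeasureTheory.Measure.integral_comp_div (fun w => _ * (starRingEnd ℂ) _) (2 * Real.pi),
    integral_fourier_mul_conj_fourier]
  · rw [abs_of_pos Real.two_pi_pos, Complex.real_smul, ← mul_assoc]
    have : (2 * Real.pi : ℂ) ≠ 0 := by exact_mod_cast Real.two_pi_pos.ne'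
    push_cast
    rw [inv_mul_cancel₀ this, one_mul, ← integral_complex_ofReal,
      ← integral_indicator measurableSet_Ioi]
    congr 1
    ext t
    by_cases ht : t ∈ Set.Ioi (0 : ℝ)
    · simp only [Set.indicator_of_mem ht]
      rw [map_mul, Complex.conj_ofReal, ← Complex.exp_conj, map_mul, map_neg,
        Complex.conj_ofReal, Complex.conj_ofReal]
      push_cast
      rw [show (-2 * σ * t : ℂ) = -σ * t + -σ * t by ring, Complex.exp_add]
      ring
    · simp only [Set.indicator_of_notMem ht, zero_mul]
  · exact (integrable_indicator_iff measurableSet_Ioi).2 hf1.ofReal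
  · exact (memLp_indicator_iff_restrict measurableSet_Ioi).2 hf2.ofReal
  · exact (integrable_indicator_iff measurableSet_Ioi).2 hg1.ofReal
  · exact (memLp_indicator_iff_restrict measurableSet_Ioi).2 hg2.ofReal

/-! ### Continuous Laguerre functions in the time domain -/

theorem integrableOn_pow_mul_exp_neg_mul (n : ℕ) {a : ℝ} (ha : 0 < a) :
    IntegrableOn (fun t : ℝ => t ^ n * Real.exp (-a * t)) (Set.Ioi 0) := by
  refine integrable_of_isBigO_exp_neg (half_pos ha) (by fun_prop) ?_
  have h := (isLittleO_pow_exp_pos_mul_atTop n (half_pos ha)).isBigO.mul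
    (Asymptotics.isBigO_refl (fun t : ℝ => Real.exp (-a * t)) atTop)
  refine h.congr_right fun t => ?_
  rw [← Real.exp_add]
  congr 1
  ring

theorem memLp_two_pow_mul_exp_neg_mul (n : ℕ) {a : ℝ} (ha : 0 < a) :
    MemLp (fun t : ℝ => t ^ n * Real.exp (-a * t)) 2 (volume.restrict (Set.Ioi 0)) := by
  rw [memLp_two_iff_integrable_sq (by fun_prop)]
  refine (integrableOn_pow_mul_exp_neg_mul (2 * n) (mul_pos two_pos ha)).congr
    (Eventually.of_forall fun t => ?_)
  simp only [mul_pow, ← Real.exp_nat_mul, pow_mul']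
  congr 2
  push_cast
  ring

theorem integrableOn_pow_mul_cexp_neg_mul (n : ℕ) {a : ℂ} (ha : 0 < a.re) :
    IntegrableOn (fun t : ℝ => (t : ℂ) ^ n * cexp (-a * t)) (Set.Ioi 0) := by
  refine Integrable.mono (integrableOn_pow_mul_exp_neg_mul n ha)
    (Continuous.aestronglyMeasurable (by fun_prop))
    (Eventually.of_forall fun t => ?_)
  simp [Complex.norm_exp]

theorem tendsto_pow_mul_cexp_neg_mul (n : ℕ) {a : ℂ} (ha : 0 < a.re) :
    Tendsto (fun t : ℝ => (t : ℂ) ^ n * cexp (-a * t)) atTop (𝓝 0) := by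
  rw [tendsto_zero_iff_norm_tendsto_zero]
  have h := (isLittleO_pow_exp_pos_mul_atTop n ha).tendsto_div_nhds_zero
  refine (tendsto_norm_zero.comp h).congr fun t => ?_
  simp [Complex.norm_exp, Real.exp_neg, div_eq_mul_inv]

/-- Induction on `n`, integrating by parts with vanishing boundary terms. -/
theorem integral_pow_mul_cexp_neg_mul (n : ℕ) {a : ℂ} (ha : 0 < a.re) :
    ∫ t in Set.Ioi (0 : ℝ), (t : ℂ) ^ n * cexp (-a * t) = n.factorial / a ^ (n + 1) := by
  have ha0 : a ≠ 0 := fun h => by simp [h] at ha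
  have hexp : ∀ t : ℝ, HasDerivAt (fun t : ℝ => cexp (-a * t)) (-a * cexp (-a * t)) t := by
    intro t
    have := ((hasDerivAt_id (t : ℂ)).const_mul (-a)).cexp.comp_ofReal
    simpa [mul_comm] using this
  induction n with
  | zero =>
    have h := integral_Ioi_of_hasDerivAt_of_tendsto' (a := (0 : ℝ))
      (f := fun t : ℝ => cexp (-a * t)) (m := 0) (fun t _ => hexp t)
      (by simpa [IntegrableOn] using (integrableOn_pow_mul_cexp_neg_mul 0 ha).const_mul (-a))
      (by simpa using tendsto_pow_mul_cexp_neg_mul 0 ha)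
    rw [integral_const_mul] at h
    simp only [pow_zero, one_mul, ofReal_zero, mul_zero, Complex.exp_zero] at h ⊢
    simp only [zero_add, pow_one, Nat.factorial_zero, Nat.cast_one]
    rw [eq_div_iff ha0]
    linear_combination -h
  | succ n ih =>
    have hd : ∀ t : ℝ, HasDerivAt (fun t : ℝ => (t : ℂ) ^ (n + 1) * cexp (-a * t))
        ((n + 1) * ((t : ℂ) ^ n * cexp (-a * t)) + -a * ((t : ℂ) ^ (n + 1) * cexp (-a * t))) t := by
      intro t
      have h1 : HasDerivAt (fun t : ℝ => (t : ℂ) ^ (n + 1)) ((n + 1) * (t : ℂ) ^ n) t := by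
        simpa using (hasDerivAt_pow (n + 1) (t : ℂ)).comp_ofReal
      refine (h1.mul (hexp t)).congr_deriv ?_
      ring
    have i1 := (integrableOn_pow_mul_cexp_neg_mul n ha).const_mul ((n : ℂ) + 1)
    have i2 := (integrableOn_pow_mul_cexp_neg_mul (n + 1) ha).const_mul (-a)
    have h := integral_Ioi_of_hasDerivAt_of_tendsto' (a := (0 : ℝ))
      (f := fun t : ℝ => (t : ℂ) ^ (n + 1) * cexp (-a * t)) (m := 0) (fun t _ => hd t)
      (i1.add i2) (tendsto_pow_mul_cexp_neg_mul (n + 1) ha)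
    rw [integral_add i1 i2, integral_const_mul, integral_const_mul, ih] at h
    simp only [ofReal_zero, ne_eq, Nat.add_eq_zero_iff, one_ne_zero, and_false, not_false_eq_true,
      zero_pow, zero_mul, sub_zero] at h
    rw [Nat.factorial_succ]
    push_cast
    have : a * ∫ t in Set.Ioi (0 : ℝ), (t : ℂ) ^ (n + 1) * cexp (-a * t) =
        (n + 1) * (n.factorial / a ^ (n + 1)) := by linear_combination -h
    rw [← mul_div_assoc, eq_div_iff (pow_ne_zero _ ha0)] at this
    rw [eq_div_iff (pow_ne_zero _ ha0)]
    linear_combination this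

/-- The impulse response of the `j`-th continuous Laguerre function. -/
def laguerreTimeC (p : ℝ) (j : ℕ) (t : ℝ) : ℝ :=
  Real.sqrt (2 * p) * Real.exp (-p * t) * laguerrePoly j (2 * p * t)

theorem laguerreTimeC_eq_sum (p : ℝ) (j : ℕ) (t : ℝ) :
    laguerreTimeC p j t = ∑ n ∈ Finset.range (j + 1),
      Real.sqrt (2 * p) * (j.choose n * (-2 * p) ^ n / n.factorial) *
        (t ^ n * Real.exp (-p * t)) := by
  rw [laguerreTimeC, laguerrePoly, Finset.mul_sum]
  refine Finset.sum_congr rfl fun n _ => ?_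
  rw [show -(2 * p * t) = -2 * p * t by ring, mul_pow]
  ring

theorem memLp_two_laguerreTimeC {p : ℝ} (hp : 0 < p) (j : ℕ) :
    MemLp (laguerreTimeC p j) 2 (volume.restrict (Set.Ioi 0)) := by
  rw [funext (laguerreTimeC_eq_sum p j)]
  exact memLp_finsetSum _ fun n _ => (memLp_two_pow_mul_exp_neg_mul n hp).const_mul _

theorem laplace_laguerreTimeC {p : ℝ} (hp : 0 < p) (j : ℕ) {s : ℂ} (hs : 0 < s.re) :
    laplace (laguerreTimeC p j) s = laguerreC p j s := by
  have ha : 0 < (s + p).re := by simp; positivity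
  have ha0 : s + p ≠ 0 := fun h => by simp [h] at ha
  have e : ∀ t : ℝ, cexp (-s * t) * (laguerreTimeC p j t : ℂ) =
      ∑ n ∈ Finset.range (j + 1),
        (Real.sqrt (2 * p) : ℂ) * (j.choose n * (-2 * p) ^ n / n.factorial) *
          ((t : ℂ) ^ n * cexp (-(s + p) * t)) := by
    intro t
    rw [laguerreTimeC_eq_sum]
    push_cast
    rw [Finset.mul_sum]
    refine Finset.sum_congr rfl fun n _ => ?_
    rw [show -(s + p) * t = -s * t + -p * t by ring, Complex.exp_add]
    ring
  rw [laplace]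
  simp_rw [e]
  rw [integral_finsetSum _ fun n _ => (integrableOn_pow_mul_cexp_neg_mul n ha).const_mul _]
  simp_rw [integral_const_mul, integral_pow_mul_cexp_neg_mul _ ha]
  -- The binomial expansion in powers of `-2p / (s + p)` matches the Laguerre polynomial term by
  -- term.
  rw [laguerreC, show (s - p) / (s + p) = -2 * p / (s + p) + 1 by field_simp; ring, add_pow,
    Finset.mul_sum]
  refine Finset.sum_congr rfl fun n _ => ?_
  have : (n.factorial : ℂ) ≠ 0 := by exact_mod_cast n.factorial_ne_zero
  rw [one_pow, div_pow]
  field_simp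
  ring

theorem laguerreTimeC_add (p τ : ℝ) (k : ℕ) (t : ℝ) :
    laguerreTimeC p k (t + τ) = ∑ ij ∈ Finset.HasAntidiagonal.antidiagonal k,
      delayMarkovC (2 * p * τ) ij.1 * laguerreTimeC p ij.2 t := by
  rw [laguerreTimeC, mul_add, mul_add, laguerrePoly_add, Real.exp_add, Finset.mul_sum]
  refine Finset.sum_congr rfl fun ij _ => ?_
  rw [delayMarkovC, laguerreTimeC, show -(2 * p * τ) / 2 = -p * τ by ring]
  ring

/-! ### The continuous Laguerre spectrum in the time domain -/

theorem spectrumC_eq_integral {p : ℝ} (hp : 0 < p) {v : ℝ → ℝ}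
    (hv : MemLp v 2 (volume.restrict (Set.Ioi 0))) (j : ℕ) :
    spectrumC p v j = ((∫ t in Set.Ioi (0 : ℝ), v t * laguerreTimeC p j t : ℝ) : ℂ) := by
  have hint : Integrable (fun t => v t * laguerreTimeC p j t) (volume.restrict (Set.Ioi 0)) :=
    hv.integrable_mul (memLp_two_laguerreTimeC hp j)
  have hle : ∀ {c : ℝ}, 0 < c → ∀ᵐ t ∂(volume.restrict (Set.Ioi (0 : ℝ))),
      ‖Real.exp (-c * t)‖ ≤ 1 := by
    intro c hc
    filter_upwards [ae_restrict_mem measurableSet_Ioi] with t ht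
    rw [Real.norm_of_nonneg (Real.exp_pos _).le, Real.exp_le_one_iff]
    have : 0 < c * t := mul_pos hc ht
    linarith
  have hbdd : ∀ {σ : ℝ}, 0 < σ → ∀ {w : ℝ → ℝ},
      MemLp w 2 (volume.restrict (Set.Ioi 0)) →
      MemLp (fun t => Real.exp (-σ * t) * w t) 2 (volume.restrict (Set.Ioi 0)) := by
    intro σ hσ w hw
    refine hw.of_le (AEStronglyMeasurable.mul (Continuous.aestronglyMeasurable (by fun_prop)) hw.1) ?_
    filter_upwards [hle hσ] with t ht
    rw [norm_mul]
    exact mul_le_of_le_one_left (norm_nonneg _) ht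
  -- The damping factor is itself in `L²`, so its product with an `L²` function is integrable; this
  -- requires `σ > 0` and explains the boundary limit.
  have hL1 : ∀ {σ : ℝ}, 0 < σ → ∀ {w : ℝ → ℝ},
      MemLp w 2 (volume.restrict (Set.Ioi 0)) →
      IntegrableOn (fun t => Real.exp (-σ * t) * w t) (Set.Ioi 0) := by
    intro σ hσ w hw
    have := memLp_two_pow_mul_exp_neg_mul 0 hσ
    simp only [pow_zero, one_mul] at this
    exact this.integrable_mul hw
  have hφ := memLp_two_laguerreTimeC hp j
  have hline : ∀ σ : ℝ, 0 < σ → (2 * Real.pi : ℂ)⁻¹ * ∫ ω : ℝ, laplace v (σ + ω * I) *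
      (starRingEnd ℂ) (laguerreC p j (σ + ω * I)) =
      ((∫ t in Set.Ioi (0 : ℝ), Real.exp (-2 * σ * t) * (v t * laguerreTimeC p j t) : ℝ) : ℂ) := by
    intro σ hσ
    rw [← integral_laplace_mul_conj_laplace (hL1 hσ hv) (hbdd hσ hv) (hL1 hσ hφ) (hbdd hσ hφ)]
    congr 2
    ext ω
    rw [laplace_laguerreTimeC hp j (by simpa using hσ)]
  rw [spectrumC, innerC]
  refine Tendsto.limUnder_eq (Tendsto.congr' (f₁ := fun σ : ℝ =>
    ((∫ t in Set.Ioi (0 : ℝ), Real.exp (-2 * σ * t) * (v t * laguerreTimeC p j t) : ℝ) : ℂ)) ?_ ?_)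
  · filter_upwards [self_mem_nhdsWithin] with σ hσ
    exact (hline σ hσ).symm
  -- Dominated convergence as `σ → 0+`, with the damping bounded by `1` and the undamped product
  -- integrable.
  · refine (Complex.continuous_ofReal.tendsto _).comp ?_
    refine tendsto_integral_filter_of_dominated_convergence
      (fun t => ‖v t * laguerreTimeC p j t‖) ?_ ?_ hint.norm ?_
    · exact Eventually.of_forall fun σ =>
        AEStronglyMeasurable.mul (by fun_prop) hint.aestronglyMeasurable
    · filter_upwards [self_mem_nhdsWithin] with σ hσ
      filter_upwards [hle (mul_pos two_pos hσ)] with t ht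
      rw [norm_mul, show -2 * σ * t = -(2 * σ) * t by ring]
      exact mul_le_of_le_one_left (norm_nonneg _) ht
    · refine Eventually.of_forall fun t => ?_
      have : Continuous fun σ : ℝ => Real.exp (-2 * σ * t) * (v t * laguerreTimeC p j t) := by
        fun_prop
      simpa using (this.tendsto 0).mono_left nhdsWithin_le_nhds

theorem spectrumC_delay {p τ : ℝ} (hp : 0 < p) (hτ : 0 ≤ τ) {u y : ℝ → ℝ}
    (hu0 : ∀ t < 0, u t = 0) (hu : MemLp u 2 (volume.restrict (Set.Ici (0 : ℝ))))
    (hy : ∀ t, 0 ≤ t → y t = u (t - τ)) (k : ℕ) :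
    spectrumC p y k = ∑ ij ∈ Finset.HasAntidiagonal.antidiagonal k,
      (delayMarkovC (2 * p * τ) ij.1 : ℂ) * spectrumC p u ij.2 := by
  have huI : MemLp u 2 (volume.restrict (Set.Ioi (0 : ℝ))) :=
    hu.mono_measure (Measure.restrict_mono Set.Ioi_subset_Ici_self le_rfl)
  have huR : MemLp u 2 volume := by
    have := (memLp_indicator_iff_restrict measurableSet_Ici).2 hu
    rwa [Set.indicator_eq_self.2] at this
    intro t ht
    by_contra h
    exact ht (hu0 t (not_le.1 h))
  have hshift : MemLp (fun t => u (t - τ)) 2 volume :=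
    huR.comp_measurePreserving (measurePreserving_sub_right volume τ)
  have hyI : MemLp y 2 (volume.restrict (Set.Ioi (0 : ℝ))) := by
    refine (memLp_congr_ae ?_).2 (hshift.restrict (Set.Ioi 0))
    filter_upwards [ae_restrict_mem measurableSet_Ioi] with t ht
    exact hy t (le_of_lt ht)
  have hint : ∀ j, Integrable (fun t => u t * laguerreTimeC p j t)
      (volume.restrict (Set.Ioi 0)) := fun j =>
    huI.integrable_mul (memLp_two_laguerreTimeC hp j)
  simp only [spectrumC_eq_integral hp huI]
  rw [spectrumC_eq_integral hp hyI]
  -- Translation by `τ` moves the delay onto the Laguerre function; on `[0, τ)` nothing is lost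
  -- because `u` vanishes at negative times.
  have key : ∫ t in Set.Ioi (0 : ℝ), y t * laguerreTimeC p k t =
      ∫ t in Set.Ioi (0 : ℝ), u t * laguerreTimeC p k (t + τ) := by
    rw [← integral_Ici_eq_integral_Ioi, ← integral_Ici_eq_integral_Ioi,
      ← integral_indicator measurableSet_Ici, ← integral_indicator measurableSet_Ici,
      ← integral_sub_right_eq_self
        ((Set.Ici (0 : ℝ)).indicator fun t => u t * laguerreTimeC p k (t + τ)) τ]
    congr 1
    ext t
    by_cases ht : 0 ≤ t - τ
    · have ht' : 0 ≤ t := by linarith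
      rw [Set.indicator_of_mem (Set.mem_Ici.2 ht'), Set.indicator_of_mem (Set.mem_Ici.2 ht),
        hy t ht', sub_add_cancel]
    · rw [Set.indicator_of_notMem (s := Set.Ici (0 : ℝ)) (a := t - τ) ht]
      by_cases ht' : 0 ≤ t
      · rw [Set.indicator_of_mem (Set.mem_Ici.2 ht'), hy t ht', hu0 _ (not_le.1 ht), zero_mul]
      · rw [Set.indicator_of_notMem (s := Set.Ici (0 : ℝ)) ht']
  rw [key]
  simp_rw [laguerreTimeC_add, Finset.mul_sum, mul_left_comm (u _)]
  rw [integral_finsetSum _ fun ij _ => (hint ij.2).const_mul _]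
  simp_rw [integral_const_mul]
  push_cast
  rfl

/-! ### Evaluation of absolutely summable power series on the closed unit disc -/

/-- The real power series `f` has absolutely summable coefficients and its sum at `x` is `v`. -/
def EvalsTo (f : PowerSeries ℝ) (x v : ℂ) : Prop :=
  (Summable fun n => ‖((PowerSeries.coeff n f : ℝ) : ℂ)‖) ∧
    HasSum (fun n => ((PowerSeries.coeff n f : ℝ) : ℂ) * x ^ n) v

theorem norm_mul_pow_le {x : ℂ} (hx : ‖x‖ ≤ 1) (c : ℂ) (n : ℕ) : ‖c * x ^ n‖ ≤ ‖c‖ := by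
  rw [norm_mul, norm_pow]
  exact mul_le_of_le_one_right (norm_nonneg _) (pow_le_one₀ (norm_nonneg _) hx)

/-- Cauchy product. Absolute summability of the coefficients is part of `EvalsTo` so that products
remain legitimate on the boundary circle. -/
theorem EvalsTo.mul {f g : PowerSeries ℝ} {x v w : ℂ} (hx : ‖x‖ ≤ 1)
    (hf : EvalsTo f x v) (hg : EvalsTo g x w) : EvalsTo (f * g) x (v * w) := by
  have e : ∀ n, ((PowerSeries.coeff n (f * g) : ℝ) : ℂ) =
      ∑ ij ∈ Finset.HasAntidiagonal.antidiagonal n,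
        ((PowerSeries.coeff ij.1 f : ℝ) : ℂ) * ((PowerSeries.coeff ij.2 g : ℝ) : ℂ) := by
    intro n
    rw [PowerSeries.coeff_mul]
    push_cast
    rfl
  have hs : Summable fun n => ‖((PowerSeries.coeff n (f * g) : ℝ) : ℂ)‖ := by
    simp_rw [e]
    exact summable_norm_sum_mul_antidiagonal_of_summable_norm
      (f := fun n => ((PowerSeries.coeff n f : ℝ) : ℂ))
      (g := fun n => ((PowerSeries.coeff n g : ℝ) : ℂ)) hf.1 hg.1
  refine ⟨hs, ?_⟩
  have hf' : Summable fun n => ‖((PowerSeries.coeff n f : ℝ) : ℂ) * x ^ n‖ :=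
    hf.1.of_nonneg_of_le (fun _ => norm_nonneg _) fun n => norm_mul_pow_le hx _ n
  have hg' : Summable fun n => ‖((PowerSeries.coeff n g : ℝ) : ℂ) * x ^ n‖ :=
    hg.1.of_nonneg_of_le (fun _ => norm_nonneg _) fun n => norm_mul_pow_le hx _ n
  have h := tsum_mul_tsum_eq_tsum_sum_antidiagonal_of_summable_norm
    (f := fun n => ((PowerSeries.coeff n f : ℝ) : ℂ) * x ^ n)
    (g := fun n => ((PowerSeries.coeff n g : ℝ) : ℂ) * x ^ n) hf' hg'
  have e2 : ∀ n, ∑ ij ∈ Finset.HasAntidiagonal.antidiagonal n,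
      ((PowerSeries.coeff ij.1 f : ℝ) : ℂ) * x ^ ij.1 *
        (((PowerSeries.coeff ij.2 g : ℝ) : ℂ) * x ^ ij.2) =
      ((PowerSeries.coeff n (f * g) : ℝ) : ℂ) * x ^ n := by
    intro n
    rw [e, Finset.sum_mul]
    refine Finset.sum_congr rfl fun ij hij => ?_
    rw [← Finset.HasAntidiagonal.mem_antidiagonal.1 hij, pow_add]
    ring
  simp_rw [e2] at h
  rw [← hf.2.tsum_eq, ← hg.2.tsum_eq, h]
  exact (hs.of_nonneg_of_le (fun _ => norm_nonneg _)
    fun n => norm_mul_pow_le hx _ n).of_norm.hasSum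

theorem EvalsTo.sub {f g : PowerSeries ℝ} {x v w : ℂ}
    (hf : EvalsTo f x v) (hg : EvalsTo g x w) : EvalsTo (f - g) x (v - w) := by
  constructor
  · refine (hf.1.add hg.1).of_nonneg_of_le (fun _ => norm_nonneg _) fun n => ?_
    rw [map_sub, ofReal_sub]
    exact norm_sub_le _ _
  · refine (hf.2.sub hg.2).congr_fun fun n => ?_
    rw [map_sub, ofReal_sub, sub_mul]

theorem evalsTo_C (a : ℝ) (x : ℂ) : EvalsTo (PowerSeries.C a) x a := by
  have h : ∀ n, n ≠ 0 → PowerSeries.coeff n (PowerSeries.C a) = 0 := fun n hn => by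
    rw [PowerSeries.coeff_C, if_neg hn]
  constructor
  · exact summable_of_ne_finset_zero (s := {0}) fun n hn => by simp [h n (by simpa using hn)]
  · simpa using hasSum_single (f := fun n =>
      ((PowerSeries.coeff n (PowerSeries.C a) : ℝ) : ℂ) * x ^ n) 0 fun n hn => by simp [h n hn]

theorem evalsTo_X (x : ℂ) : EvalsTo PowerSeries.X x x := by
  have h : ∀ n, n ≠ 1 → PowerSeries.coeff n (PowerSeries.X : PowerSeries ℝ) = 0 := fun n hn => by
    rw [PowerSeries.coeff_X, if_neg hn]
  constructor
  · exact summable_of_ne_finset_zero (s := {1}) fun n hn => by simp [h n (by simpa using hn)]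
  · simpa using hasSum_single (f := fun n =>
      ((PowerSeries.coeff n (PowerSeries.X : PowerSeries ℝ) : ℝ) : ℂ) * x ^ n) 1
      fun n hn => by simp [h n hn]

theorem EvalsTo.pow {f : PowerSeries ℝ} {x v : ℂ} (hx : ‖x‖ ≤ 1) (hf : EvalsTo f x v) (k : ℕ) :
    EvalsTo (f ^ k) x (v ^ k) := by
  induction k with
  | zero => simpa using evalsTo_C 1 x
  | succ k ih => rw [pow_succ, pow_succ]; exact ih.mul hx hf

theorem evalsTo_geomSeries {a : ℝ} (ha : |a| < 1) {x : ℂ} (hx : ‖x‖ ≤ 1) :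
    EvalsTo (geomSeries a) x (1 - a * x)⁻¹ := by
  have ha' : ‖(a : ℂ)‖ < 1 := by simpa using ha
  constructor
  · simp only [geomSeries, PowerSeries.coeff_mk, ofReal_pow, norm_pow]
    exact summable_geometric_of_lt_one (norm_nonneg _) ha'
  · simp only [geomSeries, PowerSeries.coeff_mk, ofReal_pow, ← mul_pow]
    refine hasSum_geometric_of_norm_lt_one ?_
    rw [norm_mul]
    exact (mul_le_of_le_one_right (norm_nonneg _) hx).trans_lt ha'

theorem evalsTo_laguerreSeriesD {p : ℝ} (hp1 : p < 1) (k : ℕ) {z : ℂ}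
    (hz : 1 ≤ ‖z‖) : EvalsTo (laguerreSeriesD p k) z⁻¹ (laguerreD p k z) := by
  have hξ : |Real.sqrt p| < 1 := by
    rw [abs_of_nonneg (Real.sqrt_nonneg _), Real.sqrt_lt' one_pos]
    simpa using hp1
  have hx : ‖z⁻¹‖ ≤ 1 := by rw [norm_inv]; exact inv_le_one_of_one_le₀ hz
  have hz0 : z ≠ 0 := by rintro rfl; simp at hz; linarith
  have hg := evalsTo_geomSeries hξ hx
  have hd : z - (Real.sqrt p : ℂ) ≠ 0 := by
    intro h
    rw [sub_eq_zero] at h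
    rw [h] at hz
    simp only [norm_real, Real.norm_eq_abs] at hz
    linarith
  have h := (((evalsTo_C (Real.sqrt (1 - p)) z⁻¹).mul hx ((evalsTo_X z⁻¹).mul hx hg))).mul hx
    ((((evalsTo_X z⁻¹).sub (evalsTo_C (Real.sqrt p) z⁻¹)).mul hx hg).pow hx k)
  have h1 : (1 - (Real.sqrt p : ℂ) * z⁻¹)⁻¹ = z / (z - Real.sqrt p) := by
    rw [inv_eq_one_div, div_eq_div_iff _ hd]
    · field_simp
    · intro h0
      apply hd
      field_simp at h0
      simpa using h0
  have e : laguerreD p k z = (Real.sqrt (1 - p) : ℂ) * (z⁻¹ * (1 - (Real.sqrt p : ℂ) * z⁻¹)⁻¹) *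
      ((z⁻¹ - Real.sqrt p) * (1 - (Real.sqrt p : ℂ) * z⁻¹)⁻¹) ^ k := by
    rw [laguerreD, h1]
    congr 2
    · field_simp
    · field_simp
  rw [e]
  exact h

theorem summable_norm_laguerreTimeD {p : ℝ} (hp1 : p < 1) (k : ℕ) :
    Summable fun n => ‖(laguerreTimeD p k n : ℂ)‖ :=
  (evalsTo_laguerreSeriesD hp1 k (z := 1) (by simp)).1

theorem norm_laguerreD_le {p : ℝ} (hp1 : p < 1) (k : ℕ) {z : ℂ} (hz : 1 ≤ ‖z‖) :
    ‖laguerreD p k z‖ ≤ ∑' n, ‖(laguerreTimeD p k n : ℂ)‖ := by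
  have h := evalsTo_laguerreSeriesD hp1 k hz
  have hx : ‖z⁻¹‖ ≤ 1 := by rw [norm_inv]; exact inv_le_one_of_one_le₀ hz
  rw [← h.2.tsum_eq]
  exact tsum_of_norm_bounded h.1.hasSum fun n => norm_mul_pow_le hx _ n

/-! ### The discrete Laguerre spectrum in the time domain -/

theorem integral_cexp_int_mul (l : ℤ) :
    ∫ θ in (0 : ℝ)..(2 * Real.pi), cexp (l * I * θ) = if l = 0 then (2 * Real.pi : ℂ) else 0 := by
  split_ifs with h
  · simp [h]
  · have hc : (l : ℂ) * I ≠ 0 := mul_ne_zero (by exact_mod_cast h) I_ne_zero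
    rw [integral_exp_mul_complex hc]
    have : cexp (l * I * ((2 * Real.pi : ℝ) : ℂ)) = 1 := by
      rw [← Complex.exp_int_mul_two_pi_mul_I l]
      congr 1
      push_cast
      ring
    rw [this]
    simp

theorem norm_ofReal_mul_cexp {r : ℝ} (hr : 0 ≤ r) (θ : ℝ) : ‖(r : ℂ) * cexp (θ * I)‖ = r := by
  rw [norm_mul, Complex.norm_exp_ofReal_mul_I, mul_one, norm_real, Real.norm_of_nonneg hr]

theorem integral_zpow_mul_conj_laguerreD {p : ℝ} (hp1 : p < 1) (k m : ℕ) {r : ℝ} (hr : 1 < r) :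
    ∫ θ in (0 : ℝ)..(2 * Real.pi), ((r : ℂ) * cexp (θ * I))⁻¹ ^ m *
        (starRingEnd ℂ) (laguerreD p k (r * cexp (θ * I))) =
      2 * Real.pi * ((laguerreTimeD p k m * (r⁻¹ ^ 2) ^ m : ℝ) : ℂ) := by
  have hr0 : 0 < r := by linarith
  have hrinv : r⁻¹ ≤ 1 := inv_le_one_of_one_le₀ hr.le
  have hφ := summable_norm_laguerreTimeD hp1 k
  have hterm : ∀ (n : ℕ) (θ : ℝ), ((r : ℂ) * cexp (θ * I))⁻¹ ^ m *
      (starRingEnd ℂ) ((laguerreTimeD p k n : ℂ) * ((r : ℂ) * cexp (θ * I))⁻¹ ^ n) =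
      ((laguerreTimeD p k n * r⁻¹ ^ (m + n) : ℝ) : ℂ) * cexp (((n : ℤ) - m : ℤ) * I * θ) := by
    intro n θ
    have h1 : (((n : ℤ) - m : ℤ) : ℂ) * I * θ = n * (θ * I) + m * (-(θ * I)) := by
      push_cast; ring
    rw [h1, Complex.exp_add, Complex.exp_nat_mul, Complex.exp_nat_mul]
    simp only [map_mul, map_pow, map_inv₀, conj_ofReal, ← Complex.exp_conj, conj_I]
    rw [mul_inv, mul_inv, ← Complex.exp_neg, ← Complex.exp_neg, mul_neg, neg_neg]
    push_cast
    ring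
  have key := intervalIntegral.hasSum_integral_of_dominated_convergence (μ := volume)
    (a := 0) (b := 2 * Real.pi)
    (F := fun (n : ℕ) (θ : ℝ) => ((r : ℂ) * cexp (θ * I))⁻¹ ^ m *
      (starRingEnd ℂ) ((laguerreTimeD p k n : ℂ) * ((r : ℂ) * cexp (θ * I))⁻¹ ^ n))
    (f := fun θ : ℝ => ((r : ℂ) * cexp (θ * I))⁻¹ ^ m *
      (starRingEnd ℂ) (laguerreD p k (r * cexp (θ * I))))
    (bound := fun n _ => ‖(laguerreTimeD p k n : ℂ)‖)
    (fun n => by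
      simp only [hterm]
      exact Continuous.aestronglyMeasurable (by fun_prop))
    (fun n => Eventually.of_forall fun θ _ => by
      have hx : ‖((r : ℂ) * cexp (θ * I))⁻¹‖ ≤ 1 := by
        rw [norm_inv, norm_ofReal_mul_cexp hr0.le]; exact hrinv
      rw [mul_comm]
      refine (norm_mul_pow_le hx _ _).trans ?_
      rw [RCLike.norm_conj]
      exact norm_mul_pow_le hx _ _)
    (Eventually.of_forall fun _ _ => hφ)
    (by simp)
    (Eventually.of_forall fun θ _ => by
      have hz : 1 ≤ ‖(r : ℂ) * cexp (θ * I)‖ := by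
        rw [norm_ofReal_mul_cexp hr0.le]; exact hr.le
      have h := (evalsTo_laguerreSeriesD hp1 k hz).2
      exact (Complex.hasSum_conj'.2 h).mul_left _)
  rw [← key.tsum_eq]
  simp only [hterm, intervalIntegral.integral_const_mul, integral_cexp_int_mul]
  -- Orthogonality of the exponentials leaves only `n = m`.
  rw [tsum_eq_single m]
  · rw [if_pos (sub_self _), ← two_mul, pow_mul]
    ring
  · intro n hn
    rw [if_neg (by omega), mul_zero]

theorem measurable_laguerreD (p : ℝ) (k : ℕ) : Measurable (laguerreD p k) := by
  unfold laguerreD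
  fun_prop

/-- Parseval on the circle of radius `r`. A bounded signal suffices: for `r > 1` the Z-transform is
dominated by a geometric series. -/
theorem innerD_integral {p : ℝ} (hp1 : p < 1) (d : ℕ) {v : ℕ → ℝ} {M : ℝ} (hv : ∀ t, |v t| ≤ M)
    (k : ℕ) {r : ℝ} (hr : 1 < r) :
    (2 * Real.pi : ℂ)⁻¹ * ∫ θ in (0 : ℝ)..(2 * Real.pi),
        zTransform d v (r * cexp (θ * I)) *
          (starRingEnd ℂ) (laguerreD p k (r * cexp (θ * I))) =
      ((∑' t, v t * laguerreTimeD p k (t + d) * (r⁻¹ ^ 2) ^ (t + d) : ℝ) : ℂ) := by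
  have hr0 : 0 < r := by linarith
  have hrinv : r⁻¹ < 1 := inv_lt_one_of_one_lt₀ hr
  have hri0 : 0 ≤ r⁻¹ := inv_nonneg.2 hr0.le
  have hM : 0 ≤ M := (abs_nonneg _).trans (hv 0)
  set B := ∑' n, ‖(laguerreTimeD p k n : ℂ)‖ with hB
  have hB0 : 0 ≤ B := tsum_nonneg fun _ => norm_nonneg _
  have hnorm : ∀ θ : ℝ, ‖((r : ℂ) * cexp (θ * I))⁻¹‖ = r⁻¹ := fun θ => by
    rw [norm_inv, norm_ofReal_mul_cexp hr0.le]
  have hbd : ∀ t : ℕ, ∀ θ : ℝ, ‖(v t : ℂ) * ((r : ℂ) * cexp (θ * I))⁻¹ ^ (t + d)‖ ≤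
      M * r⁻¹ ^ t := by
    intro t θ
    rw [norm_mul, norm_pow, hnorm, norm_real, pow_add]
    refine mul_le_mul (hv t) ?_ (by positivity) hM
    exact mul_le_of_le_one_right (by positivity) (pow_le_one₀ hri0 hrinv.le)
  have hgeo : Summable fun t : ℕ => M * r⁻¹ ^ t :=
    (summable_geometric_of_lt_one hri0 hrinv).mul_left M
  have key := intervalIntegral.hasSum_integral_of_dominated_convergence (μ := volume)
    (a := 0) (b := 2 * Real.pi)
    (F := fun (t : ℕ) (θ : ℝ) => (v t : ℂ) * ((r : ℂ) * cexp (θ * I))⁻¹ ^ (t + d) *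
      (starRingEnd ℂ) (laguerreD p k (r * cexp (θ * I))))
    (f := fun θ : ℝ => zTransform d v (r * cexp (θ * I)) *
      (starRingEnd ℂ) (laguerreD p k (r * cexp (θ * I))))
    (bound := fun t _ => M * r⁻¹ ^ t * B)
    (fun t => by
      have := measurable_laguerreD p k
      have h2 : Measurable (starRingEnd ℂ) := Complex.continuous_conj.measurable
      exact Measurable.aestronglyMeasurable (by fun_prop))
    (fun t => Eventually.of_forall fun θ _ => by
      rw [norm_mul, RCLike.norm_conj]
      refine mul_le_mul (hbd t θ) (norm_laguerreD_le hp1 k ?_) (norm_nonneg _) (by positivity)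
      rw [norm_ofReal_mul_cexp hr0.le]; exact hr.le)
    (Eventually.of_forall fun _ _ => hgeo.mul_right B)
    (by simp)
    (Eventually.of_forall fun θ _ => by
      have hs : Summable fun t : ℕ => (v t : ℂ) * ((r : ℂ) * cexp (θ * I))⁻¹ ^ (t + d) :=
        Summable.of_norm_bounded hgeo fun t => hbd t θ
      have e : zTransform d v (r * cexp (θ * I)) =
          ∑' t : ℕ, (v t : ℂ) * ((r : ℂ) * cexp (θ * I))⁻¹ ^ (t + d) := by
        rw [zTransform]
        congr 1
        ext t
        rw [show (-(t : ℤ) - (d : ℤ)) = -((t + d : ℕ) : ℤ) by push_cast; ring, zpow_neg,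
          zpow_natCast, inv_pow]
      rw [e]
      exact hs.hasSum.mul_right _)
  have hpi : (2 * Real.pi : ℂ) ≠ 0 := by exact_mod_cast Real.two_pi_pos.ne'
  rw [← key.tsum_eq, ← tsum_mul_left, Complex.ofReal_tsum]
  congr 1
  ext t
  simp only [mul_assoc, intervalIntegral.integral_const_mul]
  rw [integral_zpow_mul_conj_laguerreD hp1 k (t + d) hr]
  push_cast
  field_simp

theorem summable_mul_laguerreTimeD {p : ℝ} (hp1 : p < 1) (d : ℕ) {v : ℕ → ℝ} {M : ℝ}
    (hv : ∀ t, |v t| ≤ M) (k : ℕ) : Summable fun t => v t * laguerreTimeD p k (t + d) := by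
  refine Summable.of_norm_bounded
    (((summable_nat_add_iff d).2 (summable_norm_laguerreTimeD hp1 k)).mul_left M) fun t => ?_
  rw [norm_mul, norm_real]
  exact mul_le_mul_of_nonneg_right (hv t) (norm_nonneg _)

theorem spectrumD_eq_tsum {p : ℝ} (hp1 : p < 1) (d : ℕ) {v : ℕ → ℝ} {M : ℝ}
    (hv : ∀ t, |v t| ≤ M) (k : ℕ) :
    spectrumD p d v k = ((∑' t, v t * laguerreTimeD p k (t + d) : ℝ) : ℂ) := by
  have hs := summable_mul_laguerreTimeD hp1 d hv k
  rw [spectrumD, innerD]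
  refine Tendsto.limUnder_eq (Tendsto.congr' (f₁ := fun r : ℝ =>
    ((∑' t, v t * laguerreTimeD p k (t + d) * (r⁻¹ ^ 2) ^ (t + d) : ℝ) : ℂ)) ?_ ?_)
  · filter_upwards [self_mem_nhdsWithin] with r hr
    exact (innerD_integral hp1 d hv k hr).symm
  · refine (Complex.continuous_ofReal.tendsto _).comp ?_
    -- Abel-type limit `r → 1+`: the weights `r^(-2(t+d))` are at most `1` and tend to `1`.
    refine tendsto_tsum_of_dominated_convergence hs.norm ?_ ?_
    · intro t
      have : ContinuousAt (fun r : ℝ =>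
          v t * laguerreTimeD p k (t + d) * (r⁻¹ ^ 2) ^ (t + d)) 1 := by
        fun_prop (disch := norm_num)
      simpa using this.tendsto.mono_left nhdsWithin_le_nhds
    · filter_upwards [self_mem_nhdsWithin] with r (hr : 1 < r) t
      have hr0 : 0 < r := by linarith
      rw [norm_mul]
      refine mul_le_of_le_one_right (norm_nonneg _) ?_
      rw [Real.norm_of_nonneg (by positivity)]
      exact pow_le_one₀ (by positivity)
        (pow_le_one₀ (by positivity) (inv_le_one_of_one_le₀ hr.le))

theorem spectrumD_delay {p : ℝ} (hp : 0 < p) (hp1 : p < 1) (τ d : ℕ) {u y : ℕ → ℝ}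
    (hu : Summable fun t => u t ^ 2) (hu0 : d = 0 → u 0 = 0)
    (hy : ∀ t, y t = if τ ≤ t then u (t - τ) else 0) (k : ℕ) :
    spectrumD p d y k = ∑ ij ∈ Finset.HasAntidiagonal.antidiagonal k,
      (delayMarkovD p τ ij.1 : ℂ) * spectrumD p d u ij.2 := by
  set M := Real.sqrt (∑' t, u t ^ 2) with hM
  have huM : ∀ t, |u t| ≤ M := fun t =>
    Real.abs_le_sqrt (hu.le_tsum t fun _ _ => sq_nonneg _)
  have hyM : ∀ t, |y t| ≤ M := by
    intro t
    rw [hy]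
    split_ifs
    · exact huM _
    · simp [hM]
  simp only [spectrumD_eq_tsum hp1 d huM]
  rw [spectrumD_eq_tsum hp1 d hyM]
  have key : ∑' t, y t * laguerreTimeD p k (t + d) =
      ∑' t, u t * laguerreTimeD p k (t + d + τ) := by
    rw [← (add_left_injective τ).tsum_eq]
    · congr 1
      ext t
      simp only [hy, le_add_iff_nonneg_left, zero_le, if_true, add_tsub_cancel_right]
      rw [show t + τ + d = t + d + τ by ring]
    · intro t ht
      have : τ ≤ t := by
        by_contra h
        exact ht (by simp [hy, h])
      exact ⟨t - τ, Nat.sub_add_cancel this⟩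
  have hterm : ∀ t, u t * laguerreTimeD p k (t + d + τ) =
      ∑ ij ∈ Finset.HasAntidiagonal.antidiagonal k,
        delayMarkovD p τ ij.1 * (u t * laguerreTimeD p ij.2 (t + d)) := by
    intro t
    -- The shift expansion fails only at time `0`, which occurs for `d = 0` alone; there `u 0 = 0`
    -- removes the term.
    by_cases h : t + d = 0
    · obtain ⟨rfl, rfl⟩ : t = 0 ∧ d = 0 := by omega
      simp [hu0 rfl]
    · rw [laguerreTimeD_add p hp k τ _ h, Finset.mul_sum]
      exact Finset.sum_congr rfl fun _ _ => mul_left_comm _ _ _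
  have hsum : ∀ ij ∈ Finset.HasAntidiagonal.antidiagonal k, Summable fun t =>
      delayMarkovD p τ ij.1 * (u t * laguerreTimeD p ij.2 (t + d)) := fun ij _ =>
    (summable_mul_laguerreTimeD hp1 d huM ij.2).mul_left (delayMarkovD p τ ij.1)
  rw [key, tsum_congr hterm, Summable.tsum_finsetSum hsum, Complex.ofReal_sum]
  refine Finset.sum_congr rfl fun ij _ => ?_
  rw [tsum_mul_left, Complex.ofReal_mul]

end

end LaguerreDelay

/-! ### Markov parameters and recovery of the delay -/

theorem proposition3 :
    -- Continuous time
    (∀ (p τ : ℝ), 0 < p → 0 ≤ τ →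
      ∀ u y : ℝ → ℝ,
        (∀ t < 0, u t = 0) →
        MemLp u 2 (volume.restrict (Set.Ici (0 : ℝ))) →
        (∀ t, 0 ≤ t → y t = u (t - τ)) →
        LaguerreDelay.spectrumC p u 0 ≠ 0 →
        ∀ κ : ℝ, κ = 2 * p * τ →
        ∀ h : ℕ → ℂ,
          (∀ k, h k = LaguerreDelay.markov (LaguerreDelay.spectrumC p u)
            (LaguerreDelay.spectrumC p y) k) →
          (∀ k, h k = (LaguerreDelay.delayMarkovC κ k : ℂ)) ∧
          ∀ m : ℕ, 1 ≤ m →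
            (κ : ℂ) * h m = -((m + 1) * h (m + 1) + (m - 1) * h (m - 1) - 2 * m * h m) ∧
            (h m ≠ 0 →
              (κ : ℂ) = -(((m + 1) * h (m + 1) + (m - 1) * h (m - 1) - 2 * m * h m) / h m))) ∧
    -- Discrete time
    (∀ (p : ℝ) (τ d : ℕ), 0 < p → p < 1 →
      ∀ u y : ℕ → ℝ,
        Summable (fun t => u t ^ 2) →
        (d = 0 → u 0 = 0) →
        (∀ t, y t = if τ ≤ t then u (t - τ) else 0) →
        LaguerreDelay.spectrumD p d u 0 ≠ 0 →
        ∀ ξ : ℝ, ξ = Real.sqrt p →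
        ∀ h : ℕ → ℂ,
          (∀ k, h k = LaguerreDelay.markov (LaguerreDelay.spectrumD p d u)
            (LaguerreDelay.spectrumD p d y) k) →
          (∀ k, h k = (LaguerreDelay.delayMarkovD p τ k : ℂ)) ∧
          ∀ m : ℕ, 1 ≤ m →
            (τ : ℂ) * (((ξ : ℂ) - (ξ : ℂ)⁻¹) * h m) =
              -((m + 1) * h (m + 1) + (m - 1) * h (m - 1)
                + m * ((ξ : ℂ) + (ξ : ℂ)⁻¹) * h m) ∧
            (h m ≠ 0 →
              (τ : ℂ) = -(((m + 1) * h (m + 1) + (m - 1) * h (m - 1)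
                + m * ((ξ : ℂ) + (ξ : ℂ)⁻¹) * h m) / (((ξ : ℂ) - (ξ : ℂ)⁻¹) * h m)))) := by
  constructor
  · intro p τ hp hτ u y hu0 hu hy h0 κ hκ h hh
    have hval : ∀ k, h k = (LaguerreDelay.delayMarkovC κ k : ℂ) := fun k => by
      rw [hh, hκ]
      exact LaguerreDelay.markov_eq_of_convolution _ _
        (fun k => (LaguerreDelay.delayMarkovC (2 * p * τ) k : ℂ)) h0
        (LaguerreDelay.spectrumC_delay hp hτ hu0 hu hy) k
    refine ⟨hval, fun m hm => ?_⟩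
    obtain ⟨m, rfl⟩ : ∃ l, m = l + 1 := ⟨m - 1, by omega⟩
    have hrec : (κ : ℂ) * h (m + 1) =
        -(((m + 1 : ℕ) + 1) * h (m + 1 + 1) + ((m + 1 : ℕ) - 1) * h (m + 1 - 1)
          - 2 * (m + 1 : ℕ) * h (m + 1)) := by
      simp only [hval, add_tsub_cancel_right, LaguerreDelay.delayMarkovC]
      have := LaguerreDelay.assocLaguerre_neg_one_recurrence κ m
      -- The recurrence is linear, so the common factor `e^{-κ/2}` passes through it.
      have := congrArg (fun x : ℝ => ((Real.exp (-κ / 2) * x : ℝ) : ℂ)) this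
      push_cast at this ⊢
      linear_combination this
    exact ⟨hrec, fun hne => by rw [← neg_div, eq_div_iff hne, hrec]⟩
  · intro p τ d hp hp1 u y hu hu0 hy h0 ξ hξ h hh
    have hξ0 : ξ ≠ 0 := hξ ▸ (Real.sqrt_pos.2 hp).ne'
    have hval : ∀ k, h k = (LaguerreDelay.delayMarkovD p τ k : ℂ) := fun k => by
      rw [hh]
      exact LaguerreDelay.markov_eq_of_convolution _ _
        (fun k => (LaguerreDelay.delayMarkovD p τ k : ℂ)) h0
        (LaguerreDelay.spectrumD_delay hp hp1 τ d hu hu0 hy) k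
    refine ⟨hval, fun m hm => ?_⟩
    obtain ⟨m, rfl⟩ : ∃ l, m = l + 1 := ⟨m - 1, by omega⟩
    have hrec : (τ : ℂ) * (((ξ : ℂ) - (ξ : ℂ)⁻¹) * h (m + 1)) =
        -(((m + 1 : ℕ) + 1) * h (m + 1 + 1) + ((m + 1 : ℕ) - 1) * h (m + 1 - 1)
          + (m + 1 : ℕ) * ((ξ : ℂ) + (ξ : ℂ)⁻¹) * h (m + 1)) := by
      simp only [hval, add_tsub_cancel_right,
        ← LaguerreDelay.coeff_delaySeriesD_pow_eq_delayMarkovD p hp, ← hξ]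
      have := LaguerreDelay.coeff_delaySeriesD_pow_recurrence ξ hξ0 τ m
      have := congrArg (fun x : ℝ => (x : ℂ)) this
      push_cast at this ⊢
      linear_combination this
    refine ⟨hrec, fun hne => ?_⟩
    -- Here `p < 1` enters: `ξ - ξ⁻¹` vanishes only if `ξ² = p` equals `1`.
    have hξ1 : ξ ^ 2 ≠ 1 := by
      rw [hξ, Real.sq_sqrt hp.le]
      exact hp1.ne
    have hne' : (ξ : ℂ) - (ξ : ℂ)⁻¹ ≠ 0 := by
      intro h
      apply hξ1
      have h' : ξ - ξ⁻¹ = 0 := by exact_mod_cast h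
      field_simp at h'
      linarith
    rw [← neg_div, eq_div_iff (mul_ne_zero hne' hne), hrec]
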